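/- A Banach lattice homomorphism is a bounded linear operator between (real) Banach lattices that preserves finite suprema and infima. A Banach lattice $P$ is called projective if, whenever $X$ is a Banach lattice, $J$ is a closed ideal of $X$ and $Q : X \to X/J$ is the quotient map, for every Banach lattice homomorphism $T : P \to X/J$ and every $\varepsilon > 0$ there is a Banach lattice homomorphism $\hat T : P \to X$ with $T = Q \circ \hat T$ and $\|\hat T\| \le (1+\varepsilon)\|T\|$. For a lattice $\mathbb{L}$, let $\mathbb{L}^*$ be the set of all lattice homomorphisms $x^* : \mathbb{L} \to [-1,1]$, and for $f : \mathbb{L}^* \to \mathbb{R}$ put $$\|f\|_* = \sup\Big\{ \sum_{i=1}^n |r_i f(x_i^*)| : n \in \mathbb{N},\ r_i \in \mathbb{R},\ x_i^* \in \mathbb{L}^*,\ \sup_{x \in \mathbb{L}} \sum_{i=1}^n |r_i x_i^*(x)| \le 1 \Big\}.$$ Let $FBL_*\langle \mathbb{L} \rangle$ (the free Banach lattice generated by $\mathbb{L}$) be the Banach lattice generated by the evaluations $\dot\delta_x : \mathbb{L}^* \to [-1,1]$, $\dot\delta_x(x^*) = x^*(x)$ $(x \in \mathbb{L})$, that is,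 the smallest norm-closed vector sublattice containing them, inside the Banach lattice of all functions $f : \mathbb{L}^* \to \mathbb{R}$ with $\|f\|_* < \infty$, with the norm $\|\cdot\|_*$ and the pointwise operations. **Lemma.** The Banach lattice $FBL_*\langle \mathbb{N} \rangle$ generated by the linear order $\mathbb{N}$ is not projective. -/

import Mathlib

open scoped ENNReal

noncomputable section

/-! ### Lattice homomorphisms, closed ideals and quotients of Banach lattices

A Banach lattice is a type `X` with the instances
`[NormedAddCommGroup X] [NormedSpace ℝ X] [CompleteSpace X] [Lattice X] [IsOrderedAddMonoid X]
[IsOrderedModule ℝ X] [HasSolidNorm X]`. -/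

/-- A bounded linear operator is a Banach lattice homomorphism if it commutes with the two lattice
operations. -/
structure IsBanachLatticeHom {X Y : Type*} [NormedAddCommGroup X] [NormedSpace ℝ X] [Lattice X]
    [NormedAddCommGroup Y] [NormedSpace ℝ Y] [Lattice Y] (T : X →L[ℝ] Y) : Prop where
  map_sup : ∀ a b : X, T (a ⊔ b) = T a ⊔ T b
  map_inf : ∀ a b : X, T (a ⊓ b) = T a ⊓ T b

/-- A closed ideal of a Banach lattice: a norm closed linear subspace `J` such that `x ∈ J` and
`|y| ≤ |x|` imply `y ∈ J`. -/
structure ClosedIdeal (X : Type*) [NormedAddCommGroup X] [NormedSpace ℝ X] [Lattice X]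
    extends Submodule ℝ X where
  isClosed' : IsClosed (carrier : Set X)
  solid' : LatticeOrderedAddCommGroup.IsSolid carrier

namespace ClosedIdeal

section Quotient

variable {X : Type*} [NormedAddCommGroup X] [NormedSpace ℝ X] [Lattice X] (J : ClosedIdeal X)

instance : IsClosed (J.toSubmodule : Set X) := J.isClosed'

/-- The quotient `X / J`, with the quotient linear structure and the quotient norm of Mathlib. -/
def Quot : Type _ := X ⧸ J.toSubmodule

instance : NormedAddCommGroup J.Quot := inferInstanceAs (NormedAddCommGroup (X ⧸ J.toSubmodule))

instance : NormedSpace ℝ J.Quot := inferInstanceAs (NormedSpace ℝ (X ⧸ J.toSubmodule))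

instance [CompleteSpace X] : CompleteSpace J.Quot :=
  inferInstanceAs (CompleteSpace (X ⧸ J.toSubmodule))

/-- The quotient map `X → X / J`. -/
def mkQ : X →L[ℝ] J.Quot :=
  LinearMap.mkContinuous (J.toSubmodule.mkQ : X →ₗ[ℝ] X ⧸ J.toSubmodule) 1
    (fun x => by rw [one_mul]; exact Submodule.Quotient.norm_mk_le J.toSubmodule x)

theorem mkQ_apply (x : X) : J.mkQ x = (Submodule.Quotient.mk x : X ⧸ J.toSubmodule) := rfl

theorem norm_mkQ_le (x : X) : ‖J.mkQ x‖ ≤ ‖x‖ := Submodule.Quotient.norm_mk_le J.toSubmodule x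

theorem exists_norm_lt (y : J.Quot) {ε : ℝ} (hε : 0 < ε) : ∃ x : X, J.mkQ x = y ∧ ‖x‖ < ‖y‖ + ε :=
  Submodule.Quotient.norm_mk_lt (S := J.toSubmodule) y hε

theorem mkQ_surjective : Function.Surjective J.mkQ :=
  Submodule.Quotient.mk_surjective J.toSubmodule

theorem mkQ_eq_iff {x y : X} : J.mkQ x = J.mkQ y ↔ x - y ∈ J.toSubmodule :=
  Submodule.Quotient.eq J.toSubmodule

theorem mem_of_abs_le {x y : X} (hx : x ∈ J.toSubmodule) (h : |y| ≤ |x|) : y ∈ J.toSubmodule :=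
  J.solid' hx h

variable [IsOrderedAddMonoid X]

theorem abs_mem {x : X} (hx : x ∈ J.toSubmodule) : |x| ∈ J.toSubmodule :=
  J.mem_of_abs_le hx (abs_abs x).le

theorem mem_of_abs_le_add {x y z : X} (hx : x ∈ J.toSubmodule) (hy : y ∈ J.toSubmodule)
    (h : |z| ≤ |x| + |y|) : z ∈ J.toSubmodule :=
  J.mem_of_abs_le (J.toSubmodule.add_mem (J.abs_mem hx) (J.abs_mem hy)) (h.trans (le_abs_self _))

theorem sup_sub_sup_mem {a b c d : X} (h : a - c ∈ J.toSubmodule) (h' : b - d ∈ J.toSubmodule) :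
    a ⊔ b - c ⊔ d ∈ J.toSubmodule := by
  refine J.mem_of_abs_le_add h h' ?_
  calc |a ⊔ b - c ⊔ d| = |(a ⊔ b - c ⊔ b) + (c ⊔ b - c ⊔ d)| := by rw [sub_add_sub_cancel]
    _ ≤ |a ⊔ b - c ⊔ b| + |c ⊔ b - c ⊔ d| := abs_add_le _ _
    _ ≤ |a - c| + |b - d| := by
      gcongr ?_ + ?_
      · exact abs_sup_sub_sup_le_abs _ _ _
      · rw [sup_comm c, sup_comm c]
        exact abs_sup_sub_sup_le_abs _ _ _

theorem inf_sub_inf_mem {a b c d : X} (h : a - c ∈ J.toSubmodule) (h' : b - d ∈ J.toSubmodule) :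
    a ⊓ b - c ⊓ d ∈ J.toSubmodule := by
  refine J.mem_of_abs_le_add h h' ?_
  calc |a ⊓ b - c ⊓ d| = |(a ⊓ b - c ⊓ b) + (c ⊓ b - c ⊓ d)| := by rw [sub_add_sub_cancel]
    _ ≤ |a ⊓ b - c ⊓ b| + |c ⊓ b - c ⊓ d| := abs_add_le _ _
    _ ≤ |a - c| + |b - d| := by
      gcongr ?_ + ?_
      · exact abs_inf_sub_inf_le_abs _ _ _
      · rw [inf_comm c, inf_comm c]
        exact abs_inf_sub_inf_le_abs _ _ _

/-- The supremum on `X / J`, computed on representatives. -/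
def quotSup : J.Quot → J.Quot → J.Quot :=
  Quotient.map₂ (· ⊔ ·) (fun _ _ h _ _ h' =>
    (Submodule.quotientRel_def _).2 (J.sup_sub_sup_mem ((Submodule.quotientRel_def _).1 h)
      ((Submodule.quotientRel_def _).1 h')))

/-- The infimum on `X / J`, computed on representatives. -/
def quotInf : J.Quot → J.Quot → J.Quot :=
  Quotient.map₂ (· ⊓ ·) (fun _ _ h _ _ h' =>
    (Submodule.quotientRel_def _).2 (J.inf_sub_inf_mem ((Submodule.quotientRel_def _).1 h)
      ((Submodule.quotientRel_def _).1 h')))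

/-- The quotient lattice structure on `X / J`; its order is `a ≤ b ↔ a ⊔ b = b`. -/
instance : Lattice J.Quot :=
  letI : Max J.Quot := ⟨J.quotSup⟩
  letI : Min J.Quot := ⟨J.quotInf⟩
  Lattice.mk'
    (by rintro ⟨a⟩ ⟨b⟩; exact congrArg J.mkQ (sup_comm a b))
    (by rintro ⟨a⟩ ⟨b⟩ ⟨c⟩; exact congrArg J.mkQ (sup_assoc a b c))
    (by rintro ⟨a⟩ ⟨b⟩; exact congrArg J.mkQ (inf_comm a b))
    (by rintro ⟨a⟩ ⟨b⟩ ⟨c⟩; exact congrArg J.mkQ (inf_assoc a b c))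
    (by rintro ⟨a⟩ ⟨b⟩; exact congrArg J.mkQ (sup_inf_self (a := a) (b := b)))
    (by rintro ⟨a⟩ ⟨b⟩; exact congrArg J.mkQ (inf_sup_self (a := a) (b := b)))

theorem mkQ_sup (a b : X) : J.mkQ (a ⊔ b) = J.mkQ a ⊔ J.mkQ b := rfl

theorem mkQ_inf (a b : X) : J.mkQ (a ⊓ b) = J.mkQ a ⊓ J.mkQ b := rfl

theorem isBanachLatticeHom_mkQ : IsBanachLatticeHom J.mkQ := ⟨J.mkQ_sup, J.mkQ_inf⟩

theorem mkQ_abs (a : X) : J.mkQ |a| = |J.mkQ a| := by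
  rw [abs, mkQ_sup, map_neg]; rfl

theorem mkQ_mono {a b : X} (h : a ≤ b) : J.mkQ a ≤ J.mkQ b := by
  rw [← sup_eq_right, ← mkQ_sup, sup_eq_right.2 h]

instance : IsOrderedAddMonoid J.Quot where
  add_le_add_left := by
    intro a b h c
    obtain ⟨a, rfl⟩ := J.mkQ_surjective a
    obtain ⟨b, rfl⟩ := J.mkQ_surjective b
    obtain ⟨c, rfl⟩ := J.mkQ_surjective c
    rw [← sup_eq_right] at h ⊢
    rw [← map_add, ← map_add, ← mkQ_sup, ← sup_add, map_add, mkQ_sup, h, ← map_add]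

instance [IsOrderedModule ℝ X] : IsOrderedModule ℝ J.Quot :=
  IsOrderedModule.of_smul_nonneg (by
    intro r hr b hb
    obtain ⟨b, rfl⟩ := J.mkQ_surjective b
    have : J.mkQ b = J.mkQ (b ⊔ 0) := by
      rw [mkQ_sup, map_zero]; exact (sup_eq_left.2 hb).symm
    rw [this, ← map_smul, ← map_zero J.mkQ]
    exact J.mkQ_mono (smul_nonneg hr le_sup_right))

instance [HasSolidNorm X] : HasSolidNorm J.Quot where
  solid := by
    intro x y h
    refine le_of_forall_pos_lt_add fun ε hε => ?_
    obtain ⟨b, hb, hb'⟩ := J.exists_norm_lt y hε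
    obtain ⟨a, rfl⟩ := J.mkQ_surjective x
    subst hb
    have hx : J.mkQ a = J.mkQ ((a ⊓ |b|) ⊔ -|b|) := by
      rw [mkQ_sup, mkQ_inf, map_neg, mkQ_abs]
      rw [abs_le'] at h
      rw [inf_eq_left.2 h.1, sup_eq_left.2]
      exact neg_le.1 h.2
    have hle : abs ((a ⊓ |b|) ⊔ -|b|) ≤ |b| := by
      rw [abs_le']
      refine ⟨sup_le inf_le_right ?_, neg_le.1 le_sup_right⟩
      exact (neg_nonpos.2 (abs_nonneg b)).trans (abs_nonneg b)
    rw [hx]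
    exact ((J.norm_mkQ_le _).trans (norm_le_norm_of_abs_le_abs hle)).trans_lt hb'

end Quotient

end ClosedIdeal

/-- A Banach lattice `P` is projective if whenever `X` is a Banach lattice, `J` a closed ideal of
`X`, `T : P → X / J` a Banach lattice homomorphism and `ε > 0`, there is a Banach lattice
homomorphism `S : P → X` that lifts `T` and has `‖S‖ ≤ (1 + ε) ‖T‖`. -/
def IsProjectiveBanachLattice.{u} (P : Type u) [NormedAddCommGroup P] [NormedSpace ℝ P]
    [CompleteSpace P] [Lattice P] [IsOrderedAddMonoid P] [IsOrderedModule ℝ P]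
    [HasSolidNorm P] : Prop :=
  ∀ (X : Type u) [NormedAddCommGroup X] [NormedSpace ℝ X] [CompleteSpace X] [Lattice X]
    [IsOrderedAddMonoid X] [IsOrderedModule ℝ X] [HasSolidNorm X]
    (J : ClosedIdeal X) (T : P →L[ℝ] J.Quot), IsBanachLatticeHom T →
    ∀ ε : ℝ, 0 < ε →
      ∃ S : P →L[ℝ] X, IsBanachLatticeHom S ∧ J.mkQ ∘L S = T ∧ ‖S‖ ≤ (1 + ε) * ‖T‖

/-! ### The Banach lattice of functions generated by evaluations

Here `A` is a set and `K ⊆ [-1,1]^A`; the functions live on `K`. -/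

section Functions

variable {A : Type*} (K : Set (A → Set.Icc (-1 : ℝ) 1))

/-- The supremum of the sums `∑ |rᵢ f(xᵢ)|` over all finite families of `rᵢ ∈ ℝ`, `xᵢ ∈ K` with
`∑ |rᵢ xᵢ(a)| ≤ 1` for every `a ∈ A`; it may be infinite. -/
def evalNorm (f : K → ℝ) : ℝ≥0∞ :=
  ⨆ (n : ℕ) (r : Fin n → ℝ) (x : Fin n → K) (_ : ∀ a : A, ∑ i, |r i * ((x i).1 a : ℝ)| ≤ 1),
    ENNReal.ofReal (∑ i, |r i * f (x i)|)

variable {K}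

theorem evalNorm_le_iff {f : K → ℝ} {c : ℝ≥0∞} :
    evalNorm K f ≤ c ↔ ∀ (n : ℕ) (r : Fin n → ℝ) (x : Fin n → K),
      (∀ a : A, ∑ i, |r i * ((x i).1 a : ℝ)| ≤ 1) →
        ENNReal.ofReal (∑ i, |r i * f (x i)|) ≤ c := by
  simp [evalNorm, iSup_le_iff]

theorem le_evalNorm (f : K → ℝ) {n : ℕ} (r : Fin n → ℝ) (x : Fin n → K)
    (h : ∀ a : A, ∑ i, |r i * ((x i).1 a : ℝ)| ≤ 1) :
    ENNReal.ofReal (∑ i, |r i * f (x i)|) ≤ evalNorm K f :=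
  evalNorm_le_iff.1 le_rfl n r x h

theorem evalNorm_mono {f g : K → ℝ} (h : ∀ x, |f x| ≤ |g x|) : evalNorm K f ≤ evalNorm K g := by
  refine evalNorm_le_iff.2 fun n r x hx => le_trans ?_ (le_evalNorm g r x hx)
  refine ENNReal.ofReal_le_ofReal (Finset.sum_le_sum fun i _ => ?_)
  rw [abs_mul, abs_mul]
  exact mul_le_mul_of_nonneg_left (h _) (abs_nonneg _)

theorem evalNorm_add_le (f g : K → ℝ) : evalNorm K (f + g) ≤ evalNorm K f + evalNorm K g := by
  refine evalNorm_le_iff.2 fun n r x hx => ?_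
  refine le_trans ?_ (add_le_add (le_evalNorm f r x hx) (le_evalNorm g r x hx))
  rw [← ENNReal.ofReal_add (by positivity) (by positivity), ← Finset.sum_add_distrib]
  refine ENNReal.ofReal_le_ofReal (Finset.sum_le_sum fun i _ => ?_)
  rw [Pi.add_apply, mul_add]
  exact abs_add_le _ _

theorem evalNorm_smul_le (c : ℝ) (f : K → ℝ) :
    evalNorm K (c • f) ≤ ENNReal.ofReal |c| * evalNorm K f := by
  refine evalNorm_le_iff.2 fun n r x hx => ?_
  refine le_trans (le_of_eq ?_) (mul_le_mul_right (le_evalNorm f r x hx) _)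
  rw [← ENNReal.ofReal_mul (abs_nonneg _), Finset.mul_sum]
  congr 1
  refine Finset.sum_congr rfl fun i _ => ?_
  rw [Pi.smul_apply, smul_eq_mul, ← abs_mul]
  congr 1
  ring

theorem evalNorm_zero : evalNorm K 0 = 0 :=
  le_antisymm (evalNorm_le_iff.2 fun n r x _ => by simp) zero_le

theorem abs_le_evalNorm (f : K → ℝ) (x : K) : ENNReal.ofReal |f x| ≤ evalNorm K f := by
  have := le_evalNorm f (n := 1) (fun _ => 1) (fun _ => x)
    (fun a => by simpa using abs_le.2 ⟨(x.1 a).2.1, (x.1 a).2.2⟩)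
  simpa using this

variable (K)

/-- The functions of finite norm on `K`, as a linear subspace of `ℝ^K`. -/
def finNormSubmodule : Submodule ℝ (K → ℝ) where
  carrier := {f | evalNorm K f < ∞}
  add_mem' hf hg := (evalNorm_add_le _ _).trans_lt (ENNReal.add_lt_top.2 ⟨hf, hg⟩)
  zero_mem' := by simp [evalNorm_zero]
  smul_mem' c f hf :=
    (evalNorm_smul_le c f).trans_lt (ENNReal.mul_lt_top ENNReal.ofReal_lt_top hf)

theorem sup_mem_finNormSubmodule {f g : K → ℝ} (hf : f ∈ finNormSubmodule K)
    (hg : g ∈ finNormSubmodule K) : f ⊔ g ∈ finNormSubmodule K := by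
  have hf' : evalNorm K |f| < ∞ := (evalNorm_mono fun x => by simp).trans_lt hf
  have hg' : evalNorm K |g| < ∞ := (evalNorm_mono fun x => by simp).trans_lt hg
  refine lt_of_le_of_lt (evalNorm_mono (g := |f| + |g|) fun x => ?_)
    ((evalNorm_add_le _ _).trans_lt (ENNReal.add_lt_top.2 ⟨hf', hg'⟩))
  simp only [Pi.sup_apply, Pi.add_apply, Pi.abs_apply]
  rw [abs_of_nonneg (add_nonneg (abs_nonneg (f x)) (abs_nonneg (g x)))]
  refine abs_max_le_max_abs_abs.trans (max_le ?_ ?_) <;> simp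

theorem inf_mem_finNormSubmodule {f g : K → ℝ} (hf : f ∈ finNormSubmodule K)
    (hg : g ∈ finNormSubmodule K) : f ⊓ g ∈ finNormSubmodule K := by
  have h := (finNormSubmodule K).neg_mem (sup_mem_finNormSubmodule K
    ((finNormSubmodule K).neg_mem hf) ((finNormSubmodule K).neg_mem hg))
  rwa [← neg_inf, neg_neg] at h

/-- The Banach lattice of all functions of finite norm on `K`. -/
def FinNormFun : Type _ := ↥(finNormSubmodule K)

namespace FinNormFun

instance : AddCommGroup (FinNormFun K) := inferInstanceAs (AddCommGroup ↥(finNormSubmodule K))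

instance : Module ℝ (FinNormFun K) := inferInstanceAs (Module ℝ ↥(finNormSubmodule K))

/-- The pointwise order and lattice operations. -/
instance : Lattice (FinNormFun K) :=
  Subtype.lattice (P := fun f : K → ℝ => f ∈ finNormSubmodule K)
    (fun _ _ hf hg => sup_mem_finNormSubmodule K hf hg)
    (fun _ _ hf hg => inf_mem_finNormSubmodule K hf hg)

instance : CoeFun (FinNormFun K) (fun _ => K → ℝ) := ⟨fun f => f.1⟩

instance : Norm (FinNormFun K) := ⟨fun f => (evalNorm K f).toReal⟩

variable {K}

@[ext] theorem ext {f g : FinNormFun K} (h : ∀ x, f x = g x) : f = g := Subtype.ext (funext h)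

@[simp] theorem zero_apply (x : K) : (0 : FinNormFun K) x = 0 := rfl
@[simp] theorem add_apply (f g : FinNormFun K) (x : K) : (f + g) x = f x + g x := rfl
@[simp] theorem neg_apply (f : FinNormFun K) (x : K) : (-f) x = -f x := rfl
@[simp] theorem sub_apply (f g : FinNormFun K) (x : K) : (f - g) x = f x - g x := rfl
@[simp] theorem smul_apply (c : ℝ) (f : FinNormFun K) (x : K) : (c • f) x = c * f x := rfl
@[simp] theorem sup_apply (f g : FinNormFun K) (x : K) : (f ⊔ g) x = f x ⊔ g x := rfl
@[simp] theorem inf_apply (f g : FinNormFun K) (x : K) : (f ⊓ g) x = f x ⊓ g x := rfl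
@[simp] theorem abs_apply (f : FinNormFun K) (x : K) : |f| x = |f x| := rfl

theorem le_def {f g : FinNormFun K} : f ≤ g ↔ ∀ x, f x ≤ g x := Iff.rfl

theorem norm_def (f : FinNormFun K) : ‖f‖ = (evalNorm K f).toReal := rfl

theorem ofReal_norm (f : FinNormFun K) : ENNReal.ofReal ‖f‖ = evalNorm K f :=
  ENNReal.ofReal_toReal f.2.ne

theorem norm_nonneg' (f : FinNormFun K) : 0 ≤ ‖f‖ := ENNReal.toReal_nonneg

theorem norm_le_iff {f : FinNormFun K} {c : ℝ} (hc : 0 ≤ c) :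
    ‖f‖ ≤ c ↔ ∀ (n : ℕ) (r : Fin n → ℝ) (x : Fin n → K),
      (∀ a : A, ∑ i, |r i * ((x i).1 a : ℝ)| ≤ 1) → ∑ i, |r i * f (x i)| ≤ c := by
  rw [← ENNReal.ofReal_le_ofReal_iff hc, ofReal_norm, evalNorm_le_iff]
  simp only [ENNReal.ofReal_le_ofReal_iff hc]

theorem sum_le_norm (f : FinNormFun K) {n : ℕ} (r : Fin n → ℝ) (x : Fin n → K)
    (h : ∀ a : A, ∑ i, |r i * ((x i).1 a : ℝ)| ≤ 1) : ∑ i, |r i * f (x i)| ≤ ‖f‖ :=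
  (norm_le_iff (norm_nonneg' f)).1 le_rfl n r x h

theorem abs_apply_le_norm (f : FinNormFun K) (x : K) : |f x| ≤ ‖f‖ := by
  rw [← ENNReal.ofReal_le_ofReal_iff (norm_nonneg' f), ofReal_norm]
  exact abs_le_evalNorm _ x

theorem core : NormedSpace.Core ℝ (FinNormFun K) where
  norm_nonneg := norm_nonneg'
  norm_smul c f := by
    have key : ∀ (c : ℝ) (f : FinNormFun K), ‖c • f‖ ≤ |c| * ‖f‖ := by
      intro c f
      rw [← ENNReal.ofReal_le_ofReal_iff (mul_nonneg (abs_nonneg c) (norm_nonneg' f)),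
        ENNReal.ofReal_mul (abs_nonneg _), ofReal_norm, ofReal_norm]
      exact evalNorm_smul_le c _
    refine le_antisymm (key c f) ?_
    rcases eq_or_ne c 0 with rfl | hc
    · simpa using norm_nonneg' _
    · have h := key c⁻¹ (c • f)
      rw [inv_smul_smul₀ hc, abs_inv, inv_mul_eq_div, le_div_iff₀ (abs_pos.2 hc)] at h
      rw [Real.norm_eq_abs, mul_comm]
      exact h
  norm_triangle f g := by
    rw [← ENNReal.ofReal_le_ofReal_iff (add_nonneg (norm_nonneg' f) (norm_nonneg' g)),
      ENNReal.ofReal_add (norm_nonneg' f) (norm_nonneg' g), ofReal_norm, ofReal_norm, ofReal_norm]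
    exact evalNorm_add_le _ _
  norm_eq_zero_iff f := by
    refine ⟨fun h => ext fun x => ?_, fun h => ?_⟩
    · exact abs_nonpos_iff.1 (h ▸ abs_apply_le_norm f x)
    · subst h
      rw [norm_def]
      change (evalNorm K 0).toReal = 0
      rw [evalNorm_zero, ENNReal.toReal_zero]

instance : NormedAddCommGroup (FinNormFun K) := NormedAddCommGroup.ofCore core

instance : NormedSpace ℝ (FinNormFun K) := NormedSpace.ofCore core

instance : IsOrderedAddMonoid (FinNormFun K) where
  add_le_add_left _ _ h k := fun x => add_le_add_left (h x) (k x)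

instance : IsOrderedModule ℝ (FinNormFun K) :=
  IsOrderedModule.of_smul_nonneg (fun _ hr _ hf x => mul_nonneg hr (hf x))

instance : HasSolidNorm (FinNormFun K) where
  solid f g h := by
    rw [← ENNReal.ofReal_le_ofReal_iff (norm_nonneg' g), ofReal_norm, ofReal_norm]
    exact evalNorm_mono h

instance : CompleteSpace (FinNormFun K) := by
  refine Metric.complete_of_cauchySeq_tendsto fun u hu => ?_
  have hux : ∀ x : K, CauchySeq (fun n => u n x) := by
    intro x
    refine Metric.cauchySeq_iff.2 fun ε hε => ?_
    obtain ⟨N, hN⟩ := Metric.cauchySeq_iff.1 hu ε hε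
    refine ⟨N, fun m hm n hn => lt_of_le_of_lt ?_ (hN m hm n hn)⟩
    rw [dist_eq_norm, dist_eq_norm, Real.norm_eq_abs]
    exact abs_apply_le_norm (u m - u n) x
  choose g hg using fun x => cauchySeq_tendsto_of_complete (hux x)
  have key : ∀ ε > 0, ∃ N, ∀ n ≥ N, evalNorm K (fun x => u n x - g x) ≤ ENNReal.ofReal ε := by
    intro ε hε
    obtain ⟨N, hN⟩ := Metric.cauchySeq_iff.1 hu ε hε
    refine ⟨N, fun n hn => evalNorm_le_iff.2 fun k r x hx => ENNReal.ofReal_le_ofReal ?_⟩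
    refine le_of_tendsto (x := Filter.atTop) (f := fun m => ∑ i, |r i * (u n (x i) - u m (x i))|)
      ?_ ?_
    · exact tendsto_finsetSum _ fun i _ =>
        ((tendsto_const_nhds.sub (hg (x i))).const_mul (r i)).abs
    · filter_upwards [Filter.eventually_ge_atTop N] with m hm
      have h1 := hN n hn m hm
      rw [dist_eq_norm] at h1
      exact (sum_le_norm (u n - u m) r x hx).trans h1.le
  obtain ⟨N, hN⟩ := key 1 one_pos
  have hgmem : g ∈ finNormSubmodule K := by
    have h1 : (fun x => u N x - g x) ∈ finNormSubmodule K :=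
      (hN N le_rfl).trans_lt ENNReal.ofReal_lt_top
    have h2 := (finNormSubmodule K).sub_mem (u N).2 h1
    convert h2 using 1
    funext x
    simp
  let g' : FinNormFun K := ⟨g, hgmem⟩
  refine ⟨g', Metric.tendsto_atTop.2 fun ε hε => ?_⟩
  obtain ⟨M, hM⟩ := key (ε / 2) (half_pos hε)
  refine ⟨M, fun n hn => lt_of_le_of_lt ?_ (half_lt_self hε)⟩
  rw [dist_eq_norm, ← ENNReal.ofReal_le_ofReal_iff (half_pos hε).le, ofReal_norm]
  exact hM n hn

variable (K) in
/-- The evaluation function `δ_a : K → [-1,1]`, `δ_a(x) = x(a)`. -/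
def eval (a : A) : FinNormFun K :=
  ⟨fun x => (x.1 a : ℝ), by
    have h : evalNorm K (fun x => (x.1 a : ℝ)) ≤ 1 := evalNorm_le_iff.2 fun n r x hx => by
      rw [ENNReal.ofReal_le_one]; exact hx a
    exact h.trans_lt ENNReal.one_lt_top⟩

@[simp] theorem eval_apply (a : A) (x : K) : eval K a x = (x.1 a : ℝ) := rfl

end FinNormFun

/-- A linear subspace of a Banach lattice is a closed vector sublattice if it is norm closed and
closed under the lattice operations. -/
structure IsClosedSublattice {X : Type*} [NormedAddCommGroup X] [NormedSpace ℝ X] [Lattice X]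
    (V : Submodule ℝ X) : Prop where
  isClosed : IsClosed (V : Set X)
  sup_mem : ∀ {f g : X}, f ∈ V → g ∈ V → f ⊔ g ∈ V
  inf_mem : ∀ {f g : X}, f ∈ V → g ∈ V → f ⊓ g ∈ V

/-- The Banach lattice generated by the evaluations inside the Banach lattice of functions of finite
norm on `K`: the smallest closed vector sublattice containing them. -/
def generatedByEval : Submodule ℝ (FinNormFun K) :=
  sInf {V | IsClosedSublattice V ∧ ∀ a : A, FinNormFun.eval K a ∈ V}

theorem isClosedSublattice_generatedByEval : IsClosedSublattice (generatedByEval K) where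
  isClosed := by
    rw [generatedByEval, Submodule.coe_sInf]
    exact isClosed_biInter fun V hV => hV.1.isClosed
  sup_mem hf hg := by
    rw [generatedByEval, Submodule.mem_sInf] at hf hg ⊢
    exact fun V hV => hV.1.sup_mem (hf V hV) (hg V hV)
  inf_mem hf hg := by
    rw [generatedByEval, Submodule.mem_sInf] at hf hg ⊢
    exact fun V hV => hV.1.inf_mem (hf V hV) (hg V hV)

theorem eval_mem_generatedByEval (a : A) : FinNormFun.eval K a ∈ generatedByEval K := by
  rw [generatedByEval, Submodule.mem_sInf]
  exact fun V hV => hV.2 a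

/-- The Banach lattice generated by the evaluations, with the norm and the pointwise operations of
`FinNormFun K`. -/
abbrev GeneratedByEval : Type _ := ↥(generatedByEval K)

namespace GeneratedByEval

instance : Lattice (GeneratedByEval K) :=
  Subtype.lattice (P := fun f : FinNormFun K => f ∈ generatedByEval K)
    (fun _ _ hf hg => (isClosedSublattice_generatedByEval K).sup_mem hf hg)
    (fun _ _ hf hg => (isClosedSublattice_generatedByEval K).inf_mem hf hg)

instance : IsOrderedAddMonoid (GeneratedByEval K) where
  add_le_add_left _ _ h k := fun x => add_le_add_left (h x) (k.1 x)

instance : IsOrderedModule ℝ (GeneratedByEval K) :=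
  IsOrderedModule.of_smul_nonneg (fun _ hr _ hf x => mul_nonneg hr (hf x))

instance : HasSolidNorm (GeneratedByEval K) where
  solid f g h := by
    have h' : |f.1| ≤ |g.1| := h
    change ‖f.1‖ ≤ ‖g.1‖
    exact norm_le_norm_of_abs_le_abs h'

instance : CompleteSpace (GeneratedByEval K) :=
  (isClosedSublattice_generatedByEval K).isClosed.completeSpace_coe

end GeneratedByEval

end Functions

/-! ### The free Banach lattice generated by a lattice -/

/-- The set `L^*` of all lattice homomorphisms from `L` to `[-1,1]`. -/
def latticeDual (L : Type*) [Lattice L] : Set (L → Set.Icc (-1 : ℝ) 1) :=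
  {x | ∀ a b : L, x (a ⊔ b) = x a ⊔ x b ∧ x (a ⊓ b) = x a ⊓ x b}

/-- The free Banach lattice `FBL_*⟨L⟩` generated by a lattice `L`: the Banach lattice generated by
the evaluations inside the Banach lattice of all functions of finite norm on `L^*`. -/
abbrev FreeBanachLattice (L : Type*) [Lattice L] : Type _ := GeneratedByEval (latticeDual L)

end

noncomputable section

open Filter Topology

/-! ### Continuity of the generated functions in the point of evaluation. -/

section Pointwise

variable {A : Type*} {K : Set (A → Set.Icc (-1 : ℝ) 1)}

/-! Compare the increasing sequences (`latticeDual ℕ`) with all sequences in `[-1,1]` (`Set.univ`).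
Both sets contain the tails, the indicators of `{M, M + 1, …}`, which tend pointwise to `0`.
Restriction to the tails therefore sends either generated lattice into `c₀`, and it is onto with
almost optimal norm control (`exists_apply_tail_eq`). Dividing the lattice over `Set.univ` by the
functions that vanish on the tails thus gives a copy of `c₀`, and the restriction from `latticeDual
ℕ` becomes a homomorphism `T` into this quotient, of norm at most `1 + ε`
(`exists_hom_quot_tailIdeal`).

A lift `S` of `T` would turn the increasing sequence `δ_n` into an increasing sequence `F n` over
`Set.univ` with prescribed values on the tails. Since `F 0` is `1` at the constant sequence `1`,
continuity (`GeneratedByEval.tendsto_apply`) makes it nearly `1` at the indicator of `{0, …, N - 1}`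
for large `N`, and `F N` dominates it there. But `F N` is also `1` at the complementary tail, and
disjointness of the two indicators gives a norm of nearly `2`
(`GeneratedByEval.apply_Iio_add_apply_Ici_le`), too much if `‖S‖` is close to `1`. The initial
segments are not increasing for `N > 0`, so this obstruction is invisible over `latticeDual ℕ`. -/

theorem GeneratedByEval.abs_apply_le_norm (f : GeneratedByEval K) (x : K) : |f.1 x| ≤ ‖f‖ :=
  FinNormFun.abs_apply_le_norm f.1 x

/-- Elements of the generated Banach lattice are sequentially continuous for the topology of
pointwise convergence. -/
theorem GeneratedByEval.tendsto_apply (f : GeneratedByEval K) {x : ℕ → K} {y : K}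
    (h : ∀ a, Tendsto (fun n => ((x n).1 a : ℝ)) atTop (𝓝 (y.1 a : ℝ))) :
    Tendsto (fun n => f.1 (x n)) atTop (𝓝 (f.1 y)) := by
  -- The functions that converge along the given sequence form a closed sublattice containing the
  -- evaluations. Closedness is an `ε / 3` argument, since the norm dominates the uniform norm.
  let V : Submodule ℝ (FinNormFun K) :=
    { carrier := {f | Tendsto (fun n => f (x n)) atTop (𝓝 (f y))}
      add_mem' := fun hf hg => Tendsto.add hf hg
      zero_mem' := tendsto_const_nhds
      smul_mem' := fun c _ hf => Tendsto.const_mul c hf }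
  have hV : IsClosedSublattice V :=
    { isClosed := by
        refine isClosed_of_closure_subset fun f hf => Metric.tendsto_atTop.2 fun ε hε => ?_
        obtain ⟨g, hg, hfg⟩ := Metric.mem_closure_iff.1 hf (ε / 3) (by positivity)
        obtain ⟨N, hN⟩ := Metric.tendsto_atTop.1 hg (ε / 3) (by positivity)
        refine ⟨N, fun n hn => ?_⟩
        rw [dist_eq_norm] at hfg
        have h1 := abs_lt.1 ((FinNormFun.abs_apply_le_norm (f - g) (x n)).trans_lt hfg)
        have h2 := abs_lt.1 ((FinNormFun.abs_apply_le_norm (f - g) y).trans_lt hfg)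
        have h3 := hN n hn
        rw [Real.dist_eq, abs_lt] at h3 ⊢
        simp only [FinNormFun.sub_apply] at h1 h2
        constructor <;> linarith [h1.1, h1.2, h2.1, h2.2, h3.1, h3.2]
      sup_mem := fun hf hg => Tendsto.sup_nhds hf hg
      inf_mem := fun hf hg => Tendsto.inf_nhds hf hg }
  exact (Submodule.mem_sInf.1 f.2) V ⟨hV, h⟩

/-- The zero sequence can carry an arbitrarily large coefficient without violating the constraint in
the norm, so a nonzero value there would make the norm infinite. -/
theorem FinNormFun.apply_eq_zero (f : FinNormFun K) {y : K} (hy : ∀ a, (y.1 a : ℝ) = 0) :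
    f y = 0 := by
  by_contra h
  have h1 := FinNormFun.sum_le_norm f (n := 1) (fun _ => (‖f‖ + 1) / f y) (fun _ => y) (by simp [hy])
  simp only [Finset.univ_unique, Finset.sum_const, Finset.card_singleton, one_smul,
    div_mul_cancel₀ _ h] at h1
  linarith [le_abs_self (‖f‖ + 1)]

variable (K) in
/-- The evaluation `δ_a`, as an element of the Banach lattice generated by the evaluations. -/
def GeneratedByEval.of (a : A) : GeneratedByEval K :=
  ⟨FinNormFun.eval K a, eval_mem_generatedByEval K a⟩

@[simp] theorem GeneratedByEval.of_apply (a : A) (x : K) :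
    (GeneratedByEval.of K a).1 x = (x.1 a : ℝ) := rfl

theorem GeneratedByEval.norm_of_le (a : A) : ‖GeneratedByEval.of K a‖ ≤ 1 :=
  (FinNormFun.norm_le_iff zero_le_one).2 fun _ _ _ h => h a

end Pointwise

/-! ### Tails, and restriction to them as a map onto `c₀`. -/

/-- The indicator function of a set, with values in `[-1,1]`. -/
def indicatorPoint (s : Set ℕ) : ℕ → Set.Icc (-1 : ℝ) 1 :=
  fun n => ⟨s.indicator 1 n, by
    by_cases h : n ∈ s <;> simp [h]⟩

theorem indicatorPoint_apply (s : Set ℕ) (n : ℕ) :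
    (indicatorPoint s n : ℝ) = s.indicator 1 n := rfl

theorem monotone_indicatorPoint_Ici (M : ℕ) : Monotone (indicatorPoint (Set.Ici M)) := by
  intro a b hab
  change (indicatorPoint (Set.Ici M) a : ℝ) ≤ indicatorPoint (Set.Ici M) b
  by_cases h : M ≤ a
  · simp [indicatorPoint_apply, Set.indicator, h, h.trans hab]
  · simp only [indicatorPoint_apply, Set.indicator, Set.mem_Ici, h, if_false]
    split_ifs <;> simp

section Tails

variable {K : Set (ℕ → Set.Icc (-1 : ℝ) 1)} (hK : ∀ M, indicatorPoint (Set.Ici M) ∈ K)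

/-- The indicator function of `{M, M + 1, …}` as a point of `K`. -/
def tail (M : ℕ) : K := ⟨indicatorPoint (Set.Ici M), hK M⟩

theorem tail_apply (M n : ℕ) : ((tail hK M).1 n : ℝ) = if M ≤ n then 1 else 0 := by
  change (indicatorPoint (Set.Ici M) n : ℝ) = _
  simp [indicatorPoint_apply, Set.indicator]

/-- The tails converge pointwise to the zero sequence, where every function of finite norm vanishes.
-/
theorem tendsto_apply_tail (h0 : indicatorPoint ∅ ∈ K) (f : GeneratedByEval K) :
    Tendsto (fun M => f.1 (tail hK M)) atTop (𝓝 0) := by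
  let y : K := ⟨indicatorPoint ∅, h0⟩
  have hy : ∀ a, (y.1 a : ℝ) = 0 := fun a => by
    change (indicatorPoint ∅ a : ℝ) = 0
    simp [indicatorPoint_apply]
  rw [← FinNormFun.apply_eq_zero f.1 hy]
  refine f.tendsto_apply fun a => tendsto_const_nhds.congr' ?_
  filter_upwards [eventually_gt_atTop a] with M hM
  rw [hy, tail_apply, if_neg (not_le.2 hM)]

/-- The restriction of a function to the tails, as a bounded sequence. -/
def tailRestrict : NormedAddGroupHom (GeneratedByEval K) (BoundedContinuousFunction ℕ ℝ) where
  toFun f := BoundedContinuousFunction.ofNormedAddCommGroupDiscrete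
    (fun M => f.1 (tail hK M)) ‖f‖ fun _ => f.abs_apply_le_norm _
  map_add' _ _ := rfl
  bound' := ⟨1, fun f => by
    rw [one_mul]
    exact (BoundedContinuousFunction.norm_le (norm_nonneg f)).2 fun _ => f.abs_apply_le_norm _⟩

theorem tailRestrict_apply (f : GeneratedByEval K) (M : ℕ) :
    tailRestrict hK f M = f.1 (tail hK M) := rfl

theorem norm_tailRestrict_le (f : GeneratedByEval K) : ‖tailRestrict hK f‖ ≤ ‖f‖ :=
  (BoundedContinuousFunction.norm_le (norm_nonneg f)).2 fun _ => f.abs_apply_le_norm _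

/-- The bounded sequences of finite support. -/
def finSuppSeq : AddSubgroup (BoundedContinuousFunction ℕ ℝ) where
  carrier := {z | ∃ n, ∀ M, n < M → z M = 0}
  add_mem' := by
    rintro z w ⟨n, hn⟩ ⟨m, hm⟩
    exact ⟨max n m, fun M hM => by
      simp [hn M ((le_max_left n m).trans_lt hM), hm M ((le_max_right n m).trans_lt hM)]⟩
  zero_mem' := ⟨0, fun _ _ => rfl⟩
  neg_mem' := by
    rintro z ⟨n, hn⟩
    exact ⟨n, fun M hM => by simp [hn M hM]⟩

theorem mem_closure_finSuppSeq {z : BoundedContinuousFunction ℕ ℝ}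
    (hz : Tendsto z atTop (𝓝 0)) : z ∈ finSuppSeq.topologicalClosure := by
  refine Metric.mem_closure_iff.2 fun ε hε => ?_
  obtain ⟨N, hN⟩ := Metric.tendsto_atTop.1 hz (ε / 2) (half_pos hε)
  refine ⟨BoundedContinuousFunction.ofNormedAddCommGroupDiscrete
    (fun M => if M ≤ N then z M else 0) ‖z‖ fun M => ?_, ⟨N, fun M hM => ?_⟩, ?_⟩
  · split_ifs
    · exact z.norm_coe_le_norm M
    · simp
  · exact if_neg (not_le.2 hM)
  · refine lt_of_le_of_lt ((BoundedContinuousFunction.dist_le (half_pos hε).le).2 fun M => ?_)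
      (half_lt_self hε)
    change dist (z M) (if M ≤ N then z M else 0) ≤ ε / 2
    split_ifs with h
    · simpa using (half_pos hε).le
    · exact (hN M (not_le.1 h).le).le

/-- Truncating a combination of evaluations by a multiple of `|δ_n|` realizes a finitely supported
sequence by a function of the same norm. -/
theorem surjectiveOnWith_tailRestrict : (tailRestrict hK).SurjectiveOnWith finSuppSeq 1 := by
  rintro z ⟨n, hn⟩
  have hcomb : ∃ u : GeneratedByEval K, ∀ M, M ≤ n → u.1 (tail hK M) = z M := by
    suffices ∀ k, ∃ u : GeneratedByEval K, ∀ M, u.1 (tail hK M) = if M ≤ k then z M else 0 by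
      obtain ⟨u, hu⟩ := this n
      exact ⟨u, fun M hM => by rw [hu, if_pos hM]⟩
    intro k
    induction k with
    | zero =>
      refine ⟨z 0 • GeneratedByEval.of K 0, fun M => ?_⟩
      change z 0 * ((tail hK M).1 0 : ℝ) = _
      rw [tail_apply]
      rcases M with _ | M <;> simp
    | succ k ih =>
      obtain ⟨u, hu⟩ := ih
      -- On the tails, `δ_{k+1} - δ_k` is the indicator of the single index `M = k + 1`.
      refine ⟨u + z (k + 1) • (GeneratedByEval.of K (k + 1) - GeneratedByEval.of K k),
        fun M => ?_⟩
      change u.1 (tail hK M) +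
        z (k + 1) * (((tail hK M).1 (k + 1) : ℝ) - ((tail hK M).1 k : ℝ)) = _
      rw [hu, tail_apply, tail_apply]
      rcases lt_trichotomy M (k + 1) with h | rfl | h
      · simp [Nat.lt_succ_iff.1 h, h.le]
      · simp
      · simp [not_le.2 h, not_le.2 (Nat.lt_of_succ_lt h)]
  obtain ⟨u, hu⟩ := hcomb
  have hc : 0 ≤ ‖z‖ := norm_nonneg z
  -- The norm of `u` is not controlled. Clamping `u` between `-b` and `b` bounds it by `‖z‖`, keeps
  -- the values at the tails `M ≤ n`, and makes those at later tails `0`, because `δ_n` vanishes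
  -- there.
  let b : GeneratedByEval K := ‖z‖ • |GeneratedByEval.of K n|
  have hb : 0 ≤ b := smul_nonneg hc (abs_nonneg _)
  have hbt : ∀ M, b.1 (tail hK M) = if M ≤ n then ‖z‖ else 0 := fun M => by
    change ‖z‖ * |((tail hK M).1 n : ℝ)| = _
    rw [tail_apply]
    split_ifs <;> simp
  have hbn : ‖b‖ ≤ ‖z‖ := by
    rw [norm_smul, norm_norm, norm_abs_eq_norm]
    exact mul_le_of_le_one_right hc (GeneratedByEval.norm_of_le n)
  refine ⟨(u ⊓ b) ⊔ -b, ?_, ?_⟩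
  · ext M
    change (u.1 (tail hK M) ⊓ b.1 (tail hK M)) ⊔ -b.1 (tail hK M) = z M
    rw [hbt]
    split_ifs with h
    · have := abs_le.1 (z.norm_coe_le_norm M)
      rw [hu M h, inf_eq_left.2 this.2, sup_eq_left.2 this.1]
    · rw [hn M (not_le.1 h), neg_zero]
      exact sup_eq_right.2 inf_le_right
  · rw [one_mul]
    refine (norm_le_norm_of_abs_le_abs ?_).trans hbn
    rw [abs_of_nonneg hb, abs_le']
    exact ⟨sup_le inf_le_right (neg_le_self hb), neg_le.1 le_sup_right⟩

/-- Finitely supported sequences lift without loss of norm and are dense in `c₀`. Successive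
approximation in a complete space extends the lifting to the closure, at the cost of the factor `1 +
ε`. -/
theorem exists_apply_tail_eq {z : BoundedContinuousFunction ℕ ℝ}
    (hz : Tendsto z atTop (𝓝 0)) {ε : ℝ} (hε : 0 < ε) :
    ∃ g : GeneratedByEval K, (∀ M, g.1 (tail hK M) = z M) ∧ ‖g‖ ≤ (1 + ε) * ‖z‖ := by
  obtain ⟨g, hg, hgz⟩ := controlled_closure_of_complete one_pos hε
    (surjectiveOnWith_tailRestrict hK) z (mem_closure_finSuppSeq hz)
  exact ⟨g, fun M => by rw [← tailRestrict_apply, hg], hgz⟩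

/-- The closed ideal of the functions that vanish on all tails. -/
def tailIdeal : ClosedIdeal (GeneratedByEval K) where
  carrier := {f | ∀ M, f.1 (tail hK M) = 0}
  add_mem' := fun {f g} hf hg M => by
    change f.1 (tail hK M) + g.1 (tail hK M) = 0
    rw [hf M, hg M, add_zero]
  zero_mem' := fun _ => rfl
  smul_mem' := fun c f hf M => by
    change c * f.1 (tail hK M) = 0
    rw [hf M, mul_zero]
  isClosed' := by
    have : {f : GeneratedByEval K | ∀ M, f.1 (tail hK M) = 0} = tailRestrict hK ⁻¹' {0} := by
      ext f
      exact ⟨fun h => BoundedContinuousFunction.ext h, fun h M => DFunLike.congr_fun h M⟩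
    change IsClosed {f : GeneratedByEval K | ∀ M, f.1 (tail hK M) = 0}
    rw [this]
    exact isClosed_singleton.preimage (tailRestrict hK).continuous
  solid' := fun f hf g hgf M => by
    have h : |g.1 (tail hK M)| ≤ |f.1 (tail hK M)| := hgf (tail hK M)
    rw [hf M, abs_zero] at h
    exact abs_nonpos_iff.1 h

theorem mkQ_tailIdeal_eq_iff {f g : GeneratedByEval K} :
    (tailIdeal hK).mkQ f = (tailIdeal hK).mkQ g ↔
      ∀ M, f.1 (tail hK M) = g.1 (tail hK M) := by
  rw [ClosedIdeal.mkQ_eq_iff]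
  exact forall_congr' fun M => sub_eq_zero

end Tails

/-! ### The homomorphism to be lifted. -/

/-- Restriction to the tails induces a Banach lattice homomorphism into the quotient by the ideal of
the functions that vanish on the tails. -/
theorem exists_hom_quot_tailIdeal {K K' : Set (ℕ → Set.Icc (-1 : ℝ) 1)}
    (hK : ∀ M, indicatorPoint (Set.Ici M) ∈ K) (hK' : ∀ M, indicatorPoint (Set.Ici M) ∈ K')
    (h0 : indicatorPoint ∅ ∈ K) {ε : ℝ} (hε : 0 < ε) :
    ∃ T : GeneratedByEval K →L[ℝ] (tailIdeal hK').Quot, IsBanachLatticeHom T ∧ ‖T‖ ≤ 1 + ε ∧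
      ∀ f g, T f = (tailIdeal hK').mkQ g ↔ ∀ M, g.1 (tail hK' M) = f.1 (tail hK M) := by
  have hex (f : GeneratedByEval K) : ∃ g : GeneratedByEval K',
      (∀ M, g.1 (tail hK' M) = f.1 (tail hK M)) ∧ ‖g‖ ≤ (1 + ε) * ‖f‖ := by
    obtain ⟨g, hg, hgn⟩ := exists_apply_tail_eq hK' (z := tailRestrict hK f)
      (tendsto_apply_tail hK h0 f) hε
    exact ⟨g, hg, hgn.trans
      (mul_le_mul_of_nonneg_left (norm_tailRestrict_le hK f) (by positivity))⟩
  -- The choice `L` need be neither linear nor a lattice map. Its class in the quotient depends only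
  -- on the values at the tails, so composing with the quotient map repairs both.
  choose L hL hLn using hex
  have key (f : GeneratedByEval K) (g : GeneratedByEval K') :
      (tailIdeal hK').mkQ (L f) = (tailIdeal hK').mkQ g ↔
        ∀ M, g.1 (tail hK' M) = f.1 (tail hK M) := by
    rw [mkQ_tailIdeal_eq_iff]
    exact forall_congr' fun M => by rw [hL, eq_comm]
  let T₀ : GeneratedByEval K →ₗ[ℝ] (tailIdeal hK').Quot :=
    { toFun := fun f => (tailIdeal hK').mkQ (L f)
      map_add' := fun f g => by
        rw [← map_add, key]
        intro M
        change (L f).1 _ + (L g).1 _ = f.1 _ + g.1 _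
        rw [hL, hL]
      map_smul' := fun c f => by
        rw [RingHom.id_apply, ← map_smul, key]
        intro M
        change c * (L f).1 _ = c * f.1 _
        rw [hL] }
  refine ⟨T₀.mkContinuous (1 + ε) fun f => ((tailIdeal hK').norm_mkQ_le _).trans (hLn f), ⟨?_, ?_⟩,
    LinearMap.mkContinuous_norm_le _ (by positivity) _, key⟩
  · intro f g
    change (tailIdeal hK').mkQ (L (f ⊔ g)) = (tailIdeal hK').mkQ (L f) ⊔ (tailIdeal hK').mkQ (L g)
    rw [← ClosedIdeal.mkQ_sup, key]
    intro M
    change (L f).1 _ ⊔ (L g).1 _ = f.1 _ ⊔ g.1 _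
    rw [hL, hL]
  · intro f g
    change (tailIdeal hK').mkQ (L (f ⊓ g)) = (tailIdeal hK').mkQ (L f) ⊓ (tailIdeal hK').mkQ (L g)
    rw [← ClosedIdeal.mkQ_inf, key]
    intro M
    change (L f).1 _ ⊓ (L g).1 _ = f.1 _ ⊓ g.1 _
    rw [hL, hL]

/-! ### The norm estimate and the contradiction. -/

/-- The norm dominates the sum of the values at the indicators of an initial segment of `ℕ` and of
its complement. -/
theorem GeneratedByEval.apply_Iio_add_apply_Ici_le
    (f : GeneratedByEval (Set.univ : Set (ℕ → Set.Icc (-1 : ℝ) 1))) (N : ℕ) :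
    f.1 ⟨indicatorPoint (Set.Iio N), trivial⟩ + f.1 ⟨indicatorPoint (Set.Ici N), trivial⟩ ≤ ‖f‖ := by
  -- Both coefficients can be `1`: at each coordinate exactly one of the two indicators is nonzero.
  have h := FinNormFun.sum_le_norm f.1 (n := 2) (fun _ => 1)
    ![⟨indicatorPoint (Set.Iio N), trivial⟩, ⟨indicatorPoint (Set.Ici N), trivial⟩] (fun a => by
      simp only [one_mul, Fin.sum_univ_two, Matrix.cons_val_zero, Matrix.cons_val_one,
        indicatorPoint_apply]
      by_cases ha : a < N
      · simp [Set.indicator, ha]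
      · simp [Set.indicator, ha, not_lt.1 ha])
  simp only [one_mul, Fin.sum_univ_two, Matrix.cons_val_zero, Matrix.cons_val_one] at h
  exact (add_le_add (le_abs_self _) (le_abs_self _)).trans h

theorem monotone_of_latticeDual :
    Monotone (GeneratedByEval.of (latticeDual ℕ)) := by
  intro a b hab x
  have h := (x.2 a b).1
  rw [sup_eq_right.2 hab] at h
  change (x.1 a : ℝ) ≤ x.1 b
  exact Subtype.coe_le_coe.2 (sup_eq_right.1 h.symm)

end

theorem lemma4p2 : ¬ IsProjectiveBanachLattice (FreeBanachLattice ℕ) := by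
  intro hP
  have hK : ∀ M, indicatorPoint (Set.Ici M) ∈ latticeDual ℕ := fun M a b =>
    ⟨(monotone_indicatorPoint_Ici M).map_sup a b, (monotone_indicatorPoint_Ici M).map_inf a b⟩
  have hK' : ∀ M, indicatorPoint (Set.Ici M) ∈ (Set.univ : Set (ℕ → Set.Icc (-1 : ℝ) 1)) :=
    fun _ => trivial
  have h0 : indicatorPoint ∅ ∈ latticeDual ℕ := fun a b => by
    have : ∀ n, indicatorPoint ∅ n = indicatorPoint ∅ 0 := fun n => Subtype.ext (by
      simp [indicatorPoint_apply])
    simp [this a, this b, this (a ⊔ b), this (a ⊓ b)]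
  -- With `1 / 4` for both tolerances, `‖S‖ ≤ (5 / 4)² = 25 / 16`, which is below the value `3 / 4 +
  -- 1` reached at the end.
  obtain ⟨T, hT, hTn, hTq⟩ := exists_hom_quot_tailIdeal hK hK' h0 (ε := 1 / 4) (by norm_num)
  obtain ⟨S, hS, hST, hSn⟩ := hP _ (tailIdeal hK') T hT (1 / 4) (by norm_num)
  let F : ℕ → GeneratedByEval (Set.univ : Set (ℕ → Set.Icc (-1 : ℝ) 1)) :=
    fun n => S (GeneratedByEval.of (latticeDual ℕ) n)
  have hF : ∀ n M, (F n).1 (tail hK' M) = if M ≤ n then 1 else 0 := fun n M => by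
    rw [(hTq (GeneratedByEval.of (latticeDual ℕ) n) (F n)).1 (DFunLike.congr_fun hST _).symm M,
      GeneratedByEval.of_apply, tail_apply]
  have hFmono : Monotone F := fun a b hab => by
    have h := hS.map_sup (GeneratedByEval.of (latticeDual ℕ) a) (GeneratedByEval.of _ b)
    rw [sup_eq_right.2 (monotone_of_latticeDual hab)] at h
    exact sup_eq_right.1 h.symm
  have hFn : ∀ n, ‖F n‖ ≤ 25 / 16 := fun n => by
    have h1 := S.le_opNorm (GeneratedByEval.of (latticeDual ℕ) n)
    have h2 := mul_le_of_le_one_right (norm_nonneg S)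
      (GeneratedByEval.norm_of_le (K := latticeDual ℕ) n)
    change ‖F n‖ ≤ _ at h1
    linarith
  have hlim : Filter.Tendsto (fun N => (F 0).1 ⟨indicatorPoint (Set.Iio N), trivial⟩) Filter.atTop
      (nhds 1) := by
    -- The tail at `0` is the constant sequence `1`, the pointwise limit of the indicators of
    -- initial segments.
    have h1 : (F 0).1 (tail hK' 0) = 1 := by simp [hF]
    refine ((F 0).tendsto_apply fun a => tendsto_const_nhds.congr' ?_).trans (congrArg nhds h1).le
    filter_upwards [Filter.eventually_gt_atTop a] with N hN
    rw [tail_apply, indicatorPoint_apply]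
    simp [Set.indicator, hN]
  obtain ⟨N, hN⟩ := (hlim.eventually (lt_mem_nhds (show (3 / 4 : ℝ) < 1 by norm_num))).exists
  -- The order of `ℕ` enters here: `S` keeps `δ_0 ≤ δ_N`, and the resulting inequality holds at
  -- every point of `Set.univ`, not only at increasing sequences.
  have h1 : (F 0).1 ⟨indicatorPoint (Set.Iio N), trivial⟩
      ≤ (F N).1 ⟨indicatorPoint (Set.Iio N), trivial⟩ := hFmono (Nat.zero_le N) _
  have h2 : (F N).1 ⟨indicatorPoint (Set.Ici N), trivial⟩ = 1 := (hF N N).trans (if_pos le_rfl)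
  linarith [(F N).apply_Iio_add_apply_Ici_le N, hFn N]
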